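/- \textbf{Theorem 1.} Let $(\Omega,\mathcal F,\mathbb Q)$ be a probability space with a filtration $(\mathcal F_t)_{t\ge 0}$, let $\alpha\in(1,2]$, and let $L=L^{\alpha,-1}$ be a maximally skewed L\'evy-stable process relative to $(\mathcal F_t)$: $L$ is adapted, $L_0=0$ a.s., the paths are a.s. right-continuous with left limits, and for $0\le s\le t$ the increment $L_t-L_s$ is independent of $\mathcal F_s$ with characteristic function $$\mathbb E^{\mathbb Q}\big[e^{iu(L_t-L_s)}\big]=\exp\Big(-(t-s)|u|^{\alpha}\big(1+i\,\mathrm{sgn}(u)\tan\tfrac{\pi\alpha}{2}\big)\Big),\qquad u\in\mathbb R.$$ Let $r\ge 0$ be the risk-free rate, $\sigma>0$, $K>0$ the strike and $T\ge 0$ the expiry. In the finite moment log-stable (FMLS) model the log-price $x_t=\ln S_t$ satisfies $$dx_t=(r-\nu)\,dt+\sigma\,dL_t ,$$ where $\nu$ is a constant; here $\nu\in\mathbb R$ may be arbitrary (the discounted price is a martingale for the convexity adjustment $\nu=-\sigma^{\alpha}\sec\frac{\alpha\pi}{2}$). For $t\in[0,T]$ and $S>0$ let $$V(S,t)=\sup_{\gamma}\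 \mathbb E^{\mathbb Q}\big[e^{-r(\gamma-t)}(K-S_\gamma)^+\big]$$ be the American put price, where $S_u=S\exp\big((r-\nu)(u-t)+\sigma(L_u-L_t)\big)$, $u\ge t$, is the price process that equals $S$ at time $t$, and $\gamma$ runs over all $(\mathcal F_t)$-stopping times with values in $[t,T]$. Then for every fixed $t\in[0,T]$ the function $S\mapsto V(S,t)$ is convex on $(0,\infty)$. -/

import Mathlib

open MeasureTheory ProbabilityTheory Filter Topology
open scoped NNReal

/-- The characteristic exponent `ψ` of the strictly stable law `S_α(1, β, 0)` with `α ≠ 1`: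
`ψ(u) = |u|^α (1 - i β sgn(u) tan(π α / 2))`, the characteristic function being `exp (-ψ(u))`. -/
noncomputable def stableExponent (α β u : ℝ) : ℂ :=
  ((|u| ^ α : ℝ) : ℂ) *
    (1 - Complex.I * (β : ℂ) * ((Real.sign u * Real.tan (Real.pi * α / 2) : ℝ) : ℂ))

/-- The path `f : [0, ∞) → ℝ` is right-continuous with left limits. -/
def IsCadlagPath (f : ℝ≥0 → ℝ) : Prop :=
  ∀ t : ℝ≥0, ContinuousWithinAt f (Set.Ici t) t ∧ ∃ l : ℝ, Tendsto f (𝓝[<] t) (𝓝 l)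

/-- `L` is a standard Lévy-stable process with tail index `α ≠ 1` and skewness `β` (drift `0`,
scale `1`) relative to the filtration `𝓕` and the probability measure `Q`: an adapted process
starting at `0`, with almost surely càdlàg paths, whose increments `L t - L s` are independent of
`𝓕 s` and have the law `S_α((t - s)^(1/α), β, 0)`. -/
structure IsLevyStable {Ω : Type*} {mΩ : MeasurableSpace Ω} (Q : Measure Ω)
    (𝓕 : Filtration ℝ≥0 mΩ) (α β : ℝ) (L : ℝ≥0 → Ω → ℝ) : Prop where
  adapted : Adapted 𝓕 L
  start_zero : ∀ᵐ ω ∂Q, L 0 ω = 0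
  cadlag : ∀ᵐ ω ∂Q, IsCadlagPath (fun t => L t ω)
  indep_increment : ∀ s t : ℝ≥0, s ≤ t →
    Indep (MeasurableSpace.comap (fun ω => L t ω - L s ω) inferInstance) (𝓕 s) Q
  charFun_increment : ∀ s t : ℝ≥0, s ≤ t → ∀ u : ℝ,
    charFun (Q.map (fun ω => L t ω - L s ω)) u =
      Complex.exp (-((((t : ℝ) - (s : ℝ) : ℝ) : ℂ) * stableExponent α β u))

/-- The underlying price at time `u ≥ t`, given that it equals `S` at time `t`, when the log-price
`x = ln S` solves `dx = (r - ν) dt + σ dL`. -/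
noncomputable def underlying {Ω : Type*} (L : ℝ≥0 → Ω → ℝ) (r ν σ S : ℝ) (t u : ℝ≥0) (ω : Ω) : ℝ :=
  Real.exp (Real.log S + (r - ν) * ((u : ℝ) - (t : ℝ)) + σ * (L u ω - L t ω))

/-- The put pay-off `(K - S)^+` with strike `K`. -/
noncomputable def putPayoff (K S : ℝ) : ℝ := max (K - S) 0

/-- The expected discounted put pay-off, at time `t` and underlying `S`, of the exercise rule `γ`. -/
noncomputable def exerciseValue {Ω : Type*} {mΩ : MeasurableSpace Ω} (Q : Measure Ω)
    (L : ℝ≥0 → Ω → ℝ) (r ν σ K S : ℝ) (t : ℝ≥0) (γ : Ω → ℝ≥0) : ℝ :=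
  ∫ ω, Real.exp (-r * ((γ ω : ℝ) - (t : ℝ))) *
    putPayoff K (underlying L r ν σ S t (γ ω) ω) ∂Q

/-- The set of stopping times of the filtration `𝓕` with values in `[t, T]`. -/
def exerciseTimes {Ω : Type*} {mΩ : MeasurableSpace Ω} (𝓕 : Filtration ℝ≥0 mΩ) (t T : ℝ≥0) :
    Set (Ω → ℝ≥0) :=
  {γ | IsStoppingTime 𝓕 (fun ω => ((γ ω : ℝ≥0) : WithTop ℝ≥0)) ∧ ∀ ω, t ≤ γ ω ∧ γ ω ≤ T}

/-- The American put price `V(S, t)` with strike `K` and expiry `T`: the supremum of the expected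
discounted pay-offs over all stopping times with values in `[t, T]`. -/
noncomputable def americanPut {Ω : Type*} {mΩ : MeasurableSpace Ω} (Q : Measure Ω)
    (𝓕 : Filtration ℝ≥0 mΩ) (L : ℝ≥0 → Ω → ℝ) (r ν σ K : ℝ) (T : ℝ≥0) (S : ℝ) (t : ℝ≥0) : ℝ :=
  sSup (exerciseValue Q L r ν σ K S t '' exerciseTimes 𝓕 t T)

/-- The supremum in the definition of the American put price is a genuine one. -/
theorem isLUB_americanPut {Ω : Type*} {mΩ : MeasurableSpace Ω} (Q : Measure Ω)
    [IsProbabilityMeasure Q] (𝓕 : Filtration ℝ≥0 mΩ) (L : ℝ≥0 → Ω → ℝ) (r ν σ K : ℝ)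
    (hr : 0 ≤ r) (hK : 0 < K) (T : ℝ≥0) (S : ℝ) (t : ℝ≥0) (ht : t ≤ T) :
    IsLUB (exerciseValue Q L r ν σ K S t '' exerciseTimes 𝓕 t T)
      (americanPut Q 𝓕 L r ν σ K T S t) := by
  apply isLUB_csSup
  · exact Set.Nonempty.image _ ⟨fun _ => t, isStoppingTime_const 𝓕 t, fun _ => ⟨le_rfl, ht⟩⟩
  · refine ⟨K, ?_⟩
    rintro _ ⟨γ, hγ, rfl⟩
    have hb : ∀ ω, ‖Real.exp (-r * ((γ ω : ℝ) - (t : ℝ))) *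
        putPayoff K (underlying L r ν σ S t (γ ω) ω)‖ ≤ K := by
      intro ω
      have h1 : (t : ℝ) ≤ (γ ω : ℝ) := by exact_mod_cast (hγ.2 ω).1
      have h2 : Real.exp (-r * ((γ ω : ℝ) - (t : ℝ))) ≤ 1 := by
        rw [Real.exp_le_one_iff]
        nlinarith
      have h3 : putPayoff K (underlying L r ν σ S t (γ ω) ω) ≤ K := by
        have : 0 < underlying L r ν σ S t (γ ω) ω := Real.exp_pos _
        exact max_le (by linarith) hK.le
      have h4 : 0 ≤ putPayoff K (underlying L r ν σ S t (γ ω) ω) := le_max_right _ _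
      rw [Real.norm_eq_abs, abs_of_nonneg (by positivity)]
      calc _ ≤ 1 * K := mul_le_mul h2 h3 h4 zero_le_one
        _ = K := one_mul K
    have := norm_integral_le_of_norm_le_const (μ := Q) (Filter.Eventually.of_forall hb)
    rw [probReal_univ, mul_one] at this
    exact (Real.le_norm_self _).trans this

/-!
The price process started from `S > 0` is `S * X u`, where `X u` is the process started from `1`.
For a fixed exercise rule `γ`, the discounted pay-off is therefore pathwise convex in `S`, being a
nonnegative multiple of `(K - S * X γ)⁺`. Its expectation is convex (`convexOn_exerciseValue`), and
a supremum of convex functions is convex; the supremum is genuine by `isLUB_americanPut`.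

The expectation is linear only on integrable pay-offs, so integrability has to be established for
every exercise rule. As the pay-off is bounded by `K`, this reduces to the measurability of the
stopped value `L γ`. Almost every path is right-continuous, so `L γ` is the almost sure limit of
`L γₙ`, where `γₙ = (⌊(n + 1) γ⌋ + 1) / (n + 1)` lies between `γ` and `γ + 1 / (n + 1)` and takes
countably many values (`aemeasurable_stoppedValue_of_rightContinuous`).
-/

theorem measurable_apply_nat {Ω : Type*} {mΩ : MeasurableSpace Ω} {f : ℕ → Ω → ℝ}
    (hf : ∀ k, Measurable (f k)) {m : Ω → ℕ} (hm : Measurable m) :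
    Measurable fun ω => f (m ω) ω := by
  have h : Measurable fun p : ℕ × Ω => f p.1 p.2 := measurable_from_prod_countable_right hf
  exact h.comp (hm.prodMk measurable_id)

/-- The random variable `X γ` is a.e. measurable for every measurable random time `γ`, if almost
every path of `X` is right-continuous. No joint measurability of `X` is assumed: off a null set
the paths may be irregular. -/
theorem aemeasurable_stoppedValue_of_rightContinuous {Ω : Type*} {mΩ : MeasurableSpace Ω}
    {Q : Measure Ω} {X : ℝ≥0 → Ω → ℝ} (hX : ∀ t, Measurable (X t))
    (hcont : ∀ᵐ ω ∂Q, ∀ t, ContinuousWithinAt (fun s => X s ω) (Set.Ici t) t)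
    {γ : Ω → ℝ≥0} (hγ : Measurable γ) : AEMeasurable (fun ω => X (γ ω) ω) Q := by
  let a : ℕ → Ω → ℝ≥0 := fun n ω => ((⌊((n : ℝ≥0) + 1) * γ ω⌋₊ : ℝ≥0) + 1) / ((n : ℝ≥0) + 1)
  have ha_ge (n : ℕ) (ω : Ω) : γ ω ≤ a n ω := by
    rw [le_div_iff₀ (by positivity), mul_comm]
    exact (Nat.lt_floor_add_one _).le
  have ha_le (n : ℕ) (ω : Ω) : a n ω ≤ γ ω + 1 / ((n : ℝ≥0) + 1) := by
    have h : γ ω + 1 / ((n : ℝ≥0) + 1) = (((n : ℝ≥0) + 1) * γ ω + 1) / ((n : ℝ≥0) + 1) := by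
      field_simp
    rw [h]
    exact div_le_div_of_nonneg_right (add_le_add_left (Nat.floor_le zero_le) 1) zero_le
  have ha_tendsto (ω : Ω) : Tendsto (fun n => a n ω) atTop (𝓝[≥] (γ ω)) := by
    refine tendsto_nhdsWithin_iff.2 ⟨?_, Eventually.of_forall fun n => ha_ge n ω⟩
    refine tendsto_of_tendsto_of_tendsto_of_le_of_le tendsto_const_nhds ?_
      (fun n => ha_ge n ω) (fun n => ha_le n ω)
    simpa using tendsto_const_nhds.add (tendsto_one_div_add_atTop_nhds_zero_nat (𝕜 := ℝ≥0))
  refine aemeasurable_of_tendsto_metrizable_ae atTop (f := fun n ω => X (a n ω) ω)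
    (fun n => Measurable.aemeasurable ?_) ?_
  · exact measurable_apply_nat (f := fun k => X (((k : ℝ≥0) + 1) / ((n : ℝ≥0) + 1))) (fun k => hX _)
      (Nat.measurable_floor.comp (hγ.const_mul ((n : ℝ≥0) + 1)))
  · filter_upwards [hcont] with ω hω
    exact (hω (γ ω)).tendsto.comp (ha_tendsto ω)

theorem measurable_of_mem_exerciseTimes {Ω : Type*} {mΩ : MeasurableSpace Ω}
    {𝓕 : Filtration ℝ≥0 mΩ} {t T : ℝ≥0} {γ : Ω → ℝ≥0} (hγ : γ ∈ exerciseTimes 𝓕 t T) :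
    Measurable γ := by
  refine measurable_of_Iic fun s => ?_
  have h := 𝓕.le s _ (hγ.1 s)
  simp only [WithTop.coe_le_coe] at h
  exact h

theorem underlying_eq_mul {Ω : Type*} (L : ℝ≥0 → Ω → ℝ) (r ν σ : ℝ) {S : ℝ} (hS : 0 < S)
    (t u : ℝ≥0) (ω : Ω) : underlying L r ν σ S t u ω = S * underlying L r ν σ 1 t u ω := by
  simp only [underlying, Real.log_one, zero_add, add_assoc]
  rw [Real.exp_add, Real.exp_log hS]

theorem convexOn_putPayoff (K : ℝ) : ConvexOn ℝ Set.univ (putPayoff K) :=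
  ((convexOn_const K convex_univ).sub (concaveOn_id convex_univ)).sup
    (convexOn_const 0 convex_univ)

theorem integrable_discounted_putPayoff {Ω : Type*} {mΩ : MeasurableSpace Ω} {Q : Measure Ω}
    [IsFiniteMeasure Q] {L : ℝ≥0 → Ω → ℝ} (hL : ∀ t, Measurable (L t))
    (hcont : ∀ᵐ ω ∂Q, ∀ t, ContinuousWithinAt (fun s => L s ω) (Set.Ici t) t)
    {r ν σ K S : ℝ} (hr : 0 ≤ r) (hK : 0 ≤ K) {t : ℝ≥0} {γ : Ω → ℝ≥0} (hγ : Measurable γ)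
    (htγ : ∀ ω, t ≤ γ ω) :
    Integrable (fun ω => Real.exp (-r * ((γ ω : ℝ) - (t : ℝ))) *
      putPayoff K (underlying L r ν σ S t (γ ω) ω)) Q := by
  have hLγ := aemeasurable_stoppedValue_of_rightContinuous hL hcont hγ
  have hLt := (hL t).aemeasurable (μ := Q)
  have hγ' : AEMeasurable (fun ω => (γ ω : ℝ)) Q := hγ.coe_nnreal_real.aemeasurable
  refine Integrable.of_bound (C := K) ?_ (Eventually.of_forall fun ω => ?_)
  · refine AEMeasurable.aestronglyMeasurable ?_
    exact (Real.measurable_exp.comp_aemeasurable ((hγ'.sub_const _).const_mul _)).mul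
      (((Real.measurable_exp.comp_aemeasurable ((((hγ'.sub_const _).const_mul _).const_add _).add
        ((hLγ.sub hLt).const_mul σ))).const_sub K).max aemeasurable_const)
  · have h1 : (t : ℝ) ≤ γ ω := by exact_mod_cast htγ ω
    have h2 : Real.exp (-r * ((γ ω : ℝ) - (t : ℝ))) ≤ 1 := by
      rw [Real.exp_le_one_iff]
      nlinarith
    have h3 : putPayoff K (underlying L r ν σ S t (γ ω) ω) ≤ K :=
      max_le (sub_le_self K (Real.exp_pos _).le) hK
    have h4 : 0 ≤ putPayoff K (underlying L r ν σ S t (γ ω) ω) := le_max_right _ _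
    rw [Real.norm_eq_abs, abs_of_nonneg (by positivity)]
    exact (mul_le_of_le_one_left h4 h2).trans h3

theorem convexOn_exerciseValue {Ω : Type*} {mΩ : MeasurableSpace Ω} {Q : Measure Ω}
    [IsFiniteMeasure Q] {L : ℝ≥0 → Ω → ℝ} (hL : ∀ t, Measurable (L t))
    (hcont : ∀ᵐ ω ∂Q, ∀ t, ContinuousWithinAt (fun s => L s ω) (Set.Ici t) t)
    {r ν σ K : ℝ} (hr : 0 ≤ r) (hK : 0 ≤ K) {t : ℝ≥0} {γ : Ω → ℝ≥0} (hγ : Measurable γ)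
    (htγ : ∀ ω, t ≤ γ ω) :
    ConvexOn ℝ (Set.Ioi (0 : ℝ)) (fun S => exerciseValue Q L r ν σ K S t γ) := by
  refine ⟨convex_Ioi 0, fun x hx y hy a b ha hb hab => ?_⟩
  have hint (S : ℝ) := integrable_discounted_putPayoff (ν := ν) (σ := σ) (S := S)
    hL hcont hr hK hγ htγ
  simp only [smul_eq_mul, exerciseValue]
  rw [← integral_const_mul, ← integral_const_mul,
    ← integral_add ((hint x).const_mul a) ((hint y).const_mul b)]
  refine integral_mono (hint _) (((hint x).const_mul a).add ((hint y).const_mul b)) fun ω => ?_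
  have hxy : 0 < a * x + b * y := convex_Ioi (0 : ℝ) hx hy ha hb hab
  have hu : underlying L r ν σ (a * x + b * y) t (γ ω) ω =
      a * underlying L r ν σ x t (γ ω) ω + b * underlying L r ν σ y t (γ ω) ω := by
    rw [underlying_eq_mul L r ν σ hxy, underlying_eq_mul L r ν σ hx, underlying_eq_mul L r ν σ hy]
    ring
  have hp := (convexOn_putPayoff K).2 (Set.mem_univ (underlying L r ν σ x t (γ ω) ω))
    (Set.mem_univ (underlying L r ν σ y t (γ ω) ω)) ha hb hab
  simp only [smul_eq_mul] at hp
  beta_reduce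
  rw [hu]
  refine (mul_le_mul_of_nonneg_left hp (Real.exp_pos _).le).trans_eq ?_
  ring

/-- Convexity of the American put price in the underlying, for every fixed time. The constant `ν`
is arbitrary; the discounted price is a martingale when `ν = -σ^α sec(α π / 2)`. -/
theorem theorem1 {Ω : Type*} {mΩ : MeasurableSpace Ω} (Q : Measure Ω) [IsProbabilityMeasure Q]
    (𝓕 : Filtration ℝ≥0 mΩ) (α : ℝ) (hα₁ : 1 < α) (hα₂ : α ≤ 2)
    (L : ℝ≥0 → Ω → ℝ) (hL : IsLevyStable Q 𝓕 α (-1) L)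
    (r : ℝ) (hr : 0 ≤ r) (ν : ℝ) (σ : ℝ) (hσ : 0 < σ) (K : ℝ) (hK : 0 < K)
    (T t : ℝ≥0) (ht : t ≤ T) :
    ConvexOn ℝ (Set.Ioi (0 : ℝ)) (fun S : ℝ => americanPut Q 𝓕 L r ν σ K T S t) := by
  refine ⟨convex_Ioi 0, fun x hx y hy a b ha hb hab => ?_⟩
  have hlub (S : ℝ) := isLUB_americanPut Q 𝓕 L r ν σ K hr hK T S t ht
  refine (hlub (a • x + b • y)).2 ?_
  rintro _ ⟨γ, hγ, rfl⟩
  have hconv := convexOn_exerciseValue (Q := Q) (L := L) (ν := ν) (σ := σ)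
    (fun s => (hL.adapted s).mono (𝓕.le s) le_rfl)
    (hL.cadlag.mono fun ω h s => (h s).1) hr hK.le
    (measurable_of_mem_exerciseTimes hγ) fun ω => (hγ.2 ω).1
  refine (hconv.2 hx hy ha hb hab).trans ?_
  have h1 := (hlub x).1 (Set.mem_image_of_mem _ hγ)
  have h2 := (hlub y).1 (Set.mem_image_of_mem _ hγ)
  simp only [smul_eq_mul]
  gcongr
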